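/- Let $X$ be a locally compact Hausdorff space, let $n\ge 1$, and let $\tau=(\tau_1,\dots,\tau_n)$ be a tuple of continuous maps $\tau_i:X\to X$. A covariant representation of $\tau$ is a $*$-representation $\pi$ of $C_0(X)$ on a Hilbert space together with contractions $S_1,\dots,S_n$ such that $\pi(f)S_i=S_i\pi(f\circ\tau_i)$ for all $f\in C_0(X)$ and all $i$, in the sense that $\pi(f)S_i\pi(g)=S_i\pi((f\circ\tau_i)g)$ for all $f,g\in C_0(X)$. The semicrossed product $C_0(X)\times_\tau\mathbb F_n^+$ is the universal operator algebra for covariant representations: the norm closed algebra generated by the elements $f$ and $S_if$ $(f\in C_0(X),\ 1\le i\le n)$ in the direct sum of all covariant representations. (If $X$ is compact, it contains $S_i=S_i1$.) For a single map $\tau_i$ this is Peters' semicrossed product $A_i=C_0(X)\times_{\tau_i}\mathbb Z^+$, and $C_0(X)$ is a subalgebra of each $A_i$. The universal free product $*_{C_0(X)}A_i$ with amalgamation over $C_0(X)$ is the norm closed algebra generated by the $A_i$ in the direct sum of all families of completely contractive representations of $A_1,\dots,A_n$ on a common Hilbert space that agree on $C_0(X)$. It has the universal property of the amalgamated free product: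 the canonical maps $\iota_i:A_i\to *_{C_0(X)}A_i$ are completely isometric homomorphisms which agree on $C_0(X)$, and for every operator algebra $B$ and all completely contractive homomorphisms $\pi_i:A_i\to B$ that agree on $C_0(X)$ there is a unique completely contractive homomorphism $\phi:*_{C_0(X)}A_i\to B$ with $\phi\circ\iota_i=\pi_i$ for all $i$. Then $C_0(X)\times_\tau\mathbb F_n^+$ is completely isometrically isomorphic to $*_{C_0(X)}(C_0(X)\times_{\tau_i}\mathbb Z^+)$, by an isomorphism that maps $f$ to $\iota_i(f)$ and $S_if$ to $\iota_i(S_if)$ for all $f\in C_0(X)$ and all $i$. -/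

import Mathlib

open scoped ENNReal ZeroAtInfty

universe u v w

noncomputable section

/-! ### Concrete operator algebras and their matrix norms -/

/-- The algebra of bounded operators on `K`. -/
abbrev BOp (K : Type v) [NormedAddCommGroup K] [InnerProductSpace ℂ K] : Type v := K →L[ℂ] K

section OperatorAlgebras

variable {K : Type v} [NormedAddCommGroup K] [InnerProductSpace ℂ K]
variable {H : Type w} [NormedAddCommGroup H] [InnerProductSpace ℂ H]

/-- The operator on the Hilbert space `K ⊕ ⋯ ⊕ K` (`k` summands) defined by a `k × k` matrix of
operators on `K`. -/
def opMatrix {k : ℕ} (M : Matrix (Fin k) (Fin k) (BOp K)) :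
    PiLp 2 (fun _ : Fin k => K) →L[ℂ] PiLp 2 (fun _ : Fin k => K) :=
  (PiLp.continuousLinearEquiv 2 ℂ (fun _ : Fin k => K)).symm.toContinuousLinearMap ∘L
    (ContinuousLinearMap.pi fun i => ∑ j, M i j ∘L ContinuousLinearMap.proj j) ∘L
    (PiLp.continuousLinearEquiv 2 ℂ (fun _ : Fin k => K)).toContinuousLinearMap

/-- The norm on `k × k` matrices over an algebra `A` of operators on `K`: the operator norm on
`K ⊕ ⋯ ⊕ K`. -/
def matNorm (A : NonUnitalSubalgebra ℂ (BOp K)) {k : ℕ} (M : Matrix (Fin k) (Fin k) A) : ℝ :=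
  ‖opMatrix (M.map fun a => (a : BOp K))‖

/-- A homomorphism between algebras of operators is completely contractive if all its
amplifications to matrices are contractive. -/
def CompletelyContractive {A : NonUnitalSubalgebra ℂ (BOp K)}
    {B : NonUnitalSubalgebra ℂ (BOp H)} (φ : A →ₙₐ[ℂ] B) : Prop :=
  ∀ (k : ℕ) (M : Matrix (Fin k) (Fin k) A), matNorm B (M.map φ) ≤ matNorm A M

/-- A homomorphism between algebras of operators is completely isometric if all its
amplifications to matrices are isometric. -/
def CompletelyIsometric {A : NonUnitalSubalgebra ℂ (BOp K)}
    {B : NonUnitalSubalgebra ℂ (BOp H)} (φ : A →ₙₐ[ℂ] B) : Prop :=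
  ∀ (k : ℕ) (M : Matrix (Fin k) (Fin k) A), matNorm B (M.map φ) = matNorm A M

theorem norm_le_norm_opMatrix_one (T : BOp K) :
    ‖T‖ ≤ ‖opMatrix (k := 1) (fun _ _ => T)‖ := by
  refine T.opNorm_le_bound (ContinuousLinearMap.opNorm_nonneg _) fun x => ?_
  have h := (opMatrix (k := 1) (fun _ _ => T)).le_opNorm (WithLp.toLp 2 fun _ => x)
  simpa [opMatrix, PiLp.norm_eq_of_L2] using h

end OperatorAlgebras

/-! ### Direct sums of bounded families of operators -/

section DirectSums

variable {J : Type v} {E : J → Type u} [∀ j, NormedAddCommGroup (E j)]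
  [∀ j, InnerProductSpace ℂ (E j)]

/-- The operator `⨁ j, T j` on the Hilbert space direct sum of the spaces `E j`, for a uniformly
bounded family of operators `T j` on `E j`. -/
def directSum (T : ∀ j, BOp (E j)) (hT : ∃ C, ∀ j, ‖T j‖ ≤ C) : BOp (lp E 2) :=
  lp.mapCLM 2 T (le_max_right hT.choose 0) fun j => (hT.choose_spec j).trans (le_max_left _ _)

@[simp]
theorem directSum_apply (T : ∀ j, BOp (E j)) (hT : ∃ C, ∀ j, ‖T j‖ ≤ C) (x : lp E 2) (j : J) :
    directSum T hT x j = T j (x j) := rfl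

/-- The direct sum of a pointwise bounded family of representations of an algebra. -/
def directSumRep {B : Type*} [NonUnitalRing B] [Module ℂ B] (π : ∀ j, B →ₙₐ[ℂ] (BOp (E j)))
    (hπ : ∀ b, ∃ C, ∀ j, ‖π j b‖ ≤ C) : B →ₙₐ[ℂ] BOp (lp E 2) where
  toFun b := directSum (fun j => π j b) (hπ b)
  map_smul' c b := by ext; simp
  map_zero' := by ext; simp
  map_add' a b := by ext; simp
  map_mul' a b := by ext; simp

end DirectSums

/-! ### Semicrossed products -/

section SemicrossedProducts

variable {X : Type u} [TopologicalSpace X]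

/-- The function `(f ∘ τ) * g`. It vanishes at infinity since `g` does and `f ∘ τ` is bounded. -/
def compMul (τ : C(X, X)) (f g : C₀(X, ℂ)) : C₀(X, ℂ) where
  toFun x := f (τ x) * g x
  continuous_toFun := by fun_prop
  zero_at_infty' := by
    refine squeeze_zero_norm (a := fun x => ‖f‖ * ‖g x‖) (fun x => ?_) ?_
    · rw [norm_mul]
      gcongr
      exact f.toBCF.norm_coe_le_norm (τ x)
    · simpa using (g.zero_at_infty'.norm).const_mul ‖f‖

variable {ι : Type}

/-- A covariant representation of the maps `τ i`: a `*`-representation `π` of `C₀(X)` on a Hilbert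
space together with contractions `S i` such that `π f * S i = S i * π (f ∘ τ i)`.

The function `f ∘ τ i` is bounded and continuous but need not vanish at infinity (`τ i` need not be
proper), so it acts as a multiplier of `C₀(X)`, and the relation is written out on the vectors
`π g ξ`. These span a dense subspace if `π` is nondegenerate. In general the relation makes the closed
span of these vectors invariant under `S i`, and only this invariant subspace matters below. -/
structure CovariantRep (τ : ι → C(X, X)) : Type (u + 1) where
  /-- the Hilbert space -/
  H : Type u
  [instNormed : NormedAddCommGroup H]
  [instInner : InnerProductSpace ℂ H]
  [instComplete : CompleteSpace H]
  /-- the representation of the functions -/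
  π : C₀(X, ℂ) →⋆ₙₐ[ℂ] (BOp H)
  /-- the contractions -/
  S : ι → (BOp H)
  norm_S_le : ∀ i, ‖S i‖ ≤ 1
  covariance : ∀ i f g, π f * S i * π g = S i * π (compMul (τ i) f g)

attribute [instance] CovariantRep.instNormed CovariantRep.instInner CovariantRep.instComplete

variable (τ : ι → C(X, X))

/-- The Hilbert space of the direct sum of all covariant representations. -/
abbrev UniversalSpace : Type (u + 1) := lp (fun R : CovariantRep τ => R.H) 2

/-- The direct sum of the representations of `C₀(X)` in all covariant representations. -/
def univRep : C₀(X, ℂ) →ₙₐ[ℂ] BOp (UniversalSpace τ) :=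
  directSumRep (fun R : CovariantRep τ => (R.π : C₀(X, ℂ) →ₙₐ[ℂ] (BOp R.H)))
    fun f => ⟨‖f‖, fun R => NonUnitalStarAlgHom.norm_apply_le R.π f⟩

/-- The direct sum of the `i`-th contractions of all covariant representations. -/
def univS (i : ι) : BOp (UniversalSpace τ) :=
  directSum (fun R : CovariantRep τ => R.S i) ⟨1, fun R => R.norm_S_le i⟩

/-- The semicrossed product of `C₀(X)` by the maps `τ i`: the norm closed algebra generated by the
elements `f` and `S i * f`, for `f` in `C₀(X)`, in the direct sum of all covariant representations.
It is the closed span of the elements `S i₁ * ⋯ * S iₘ * f`. If `X` is compact it contains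
`S i * 1` (which is `S i` if `1` acts as the identity), otherwise `S i` is a multiplier of it.

For a single map this is Peters' semicrossed product. -/
def semicrossedProduct : NonUnitalSubalgebra ℂ (BOp (UniversalSpace τ)) :=
  (NonUnitalAlgebra.adjoin ℂ
    (Set.range (univRep τ) ∪ ⋃ i, Set.range fun f => univS τ i * univRep τ f)).topologicalClosure

theorem univRep_mem (f : C₀(X, ℂ)) : univRep τ f ∈ semicrossedProduct τ :=
  NonUnitalSubalgebra.le_topologicalClosure _
    (NonUnitalAlgebra.subset_adjoin ℂ (Or.inl ⟨f, rfl⟩))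

theorem univS_mul_mem (i : ι) (f : C₀(X, ℂ)) :
    univS τ i * univRep τ f ∈ semicrossedProduct τ :=
  NonUnitalSubalgebra.le_topologicalClosure _
    (NonUnitalAlgebra.subset_adjoin ℂ (Or.inr (Set.mem_iUnion.2 ⟨i, f, rfl⟩)))

/-- The inclusion of `C₀(X)` in the semicrossed product. -/
def semicrossedProduct.coeff : C₀(X, ℂ) →ₙₐ[ℂ] semicrossedProduct τ :=
  NonUnitalAlgHom.codRestrict (univRep τ) _ (univRep_mem τ)

/-- The element `S i * f` of the semicrossed product. -/
def semicrossedProduct.gen (i : ι) (f : C₀(X, ℂ)) : semicrossedProduct τ :=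
  ⟨univS τ i * univRep τ f, univS_mul_mem τ i f⟩

/-- Peters' semicrossed product of `C₀(X)` by a single map `σ`. -/
abbrev petersSemicrossedProduct (σ : C(X, X)) :=
  semicrossedProduct fun _ : Unit => σ

end SemicrossedProducts

/-! ### Free products with amalgamation -/

section FreeProducts

variable {ι : Type} {D : Type u} [NonUnitalRing D] [Module ℂ D]
variable {K : ι → Type v} [∀ i, NormedAddCommGroup (K i)] [∀ i, InnerProductSpace ℂ (K i)]
variable (A : ∀ i, NonUnitalSubalgebra ℂ (BOp (K i))) (δ : ∀ i, D →ₙₐ[ℂ] A i)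

/-- A family of completely contractive representations of the algebras `A i` on one Hilbert space
that agree on the common subalgebra `D` (embedded in `A i` by `δ i`). -/
structure AmalgamatedRep : Type (max v (w + 1)) where
  /-- the Hilbert space -/
  H : Type w
  [instNormed : NormedAddCommGroup H]
  [instInner : InnerProductSpace ℂ H]
  [instComplete : CompleteSpace H]
  /-- the representations -/
  π : ∀ i, A i →ₙₐ[ℂ] (BOp H)
  contractive : ∀ i (k : ℕ) (M : Matrix (Fin k) (Fin k) (A i)),
    ‖opMatrix (M.map (π i))‖ ≤ matNorm (A i) M
  agree : ∀ i j d, π i (δ i d) = π j (δ j d)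

attribute [instance] AmalgamatedRep.instNormed AmalgamatedRep.instInner
  AmalgamatedRep.instComplete

/-- The direct sum of the representations of `A i` in all amalgamated families of representations
on Hilbert spaces. -/
def freeRep (i : ι) : A i →ₙₐ[ℂ]
    BOp (lp (fun R : AmalgamatedRep.{u, v, w} A δ => R.H) 2) :=
  directSumRep (fun R : AmalgamatedRep.{u, v, w} A δ => R.π i) fun a =>
    ⟨matNorm (A i) (k := 1) (fun _ _ => a), fun R =>
      (norm_le_norm_opMatrix_one _).trans (R.contractive i 1 fun _ _ => a)⟩

/-- The universal free product of the operator algebras `A i` with amalgamation over `D`: the norm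
closed algebra generated by the algebras `A i` in the direct sum of all amalgamated families of
completely contractive representations on Hilbert spaces. -/
def freeProduct : NonUnitalSubalgebra ℂ
    (BOp (lp (fun R : AmalgamatedRep.{u, v, w} A δ => R.H) 2)) :=
  (NonUnitalAlgebra.adjoin ℂ (⋃ i, Set.range (freeRep.{u, v, w} A δ i))).topologicalClosure

theorem freeRep_mem (i : ι) (a : A i) : freeRep.{u, v, w} A δ i a ∈ freeProduct.{u, v, w} A δ :=
  NonUnitalSubalgebra.le_topologicalClosure _
    (NonUnitalAlgebra.subset_adjoin ℂ (Set.mem_iUnion.2 ⟨i, a, rfl⟩))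

/-- The canonical homomorphism of `A i` to the free product. -/
def freeProduct.incl (i : ι) : A i →ₙₐ[ℂ] freeProduct.{u, v, w} A δ :=
  NonUnitalAlgHom.codRestrict (freeRep.{u, v, w} A δ i) _ (freeRep_mem A δ i)

/-- The universal property of the free product with amalgamation over `D`, for completely
contractive homomorphisms into operator algebras, that is, norm closed algebras of operators on
Hilbert spaces. -/
def IsAmalgamatedFreeProduct {L : Type v} [NormedAddCommGroup L] [InnerProductSpace ℂ L]
    (F : NonUnitalSubalgebra ℂ (BOp L)) (incl : ∀ i, A i →ₙₐ[ℂ] F) : Prop :=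
  IsClosed (F : Set (BOp L)) ∧
  (∀ i, CompletelyIsometric (incl i)) ∧
  (∀ i j d, incl i (δ i d) = incl j (δ j d)) ∧
  ∀ (H : Type w) [NormedAddCommGroup H] [InnerProductSpace ℂ H] [CompleteSpace H]
    (B : NonUnitalSubalgebra ℂ (BOp H)), IsClosed (B : Set (BOp H)) →
    ∀ π : ∀ i, A i →ₙₐ[ℂ] B, (∀ i, CompletelyContractive (π i)) →
      (∀ i j d, π i (δ i d) = π j (δ j d)) →
      ∃! φ : F →ₙₐ[ℂ] B, CompletelyContractive φ ∧ ∀ i a, φ (incl i a) = π i a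

end FreeProducts

end

/-!
A covariant representation of `τ` consists of covariant representations of the single maps `τ i`
that share the representation of `C₀(X)`, so it yields an amalgamated family of completely
contractive representations of Peters' algebras. Every amalgamated family `π i` arises in this way:
a contractive representation `π` of the C⋆-algebra `C₀(X)` preserves adjoints, and the map
`f ↦ π i (S f)` is a contractive module map over `π`, so that an approximate unit of `C₀(X)`
provides a contraction `S i` with `π i (S f) = S i * π f`. Hence the two algebras have the same
universal property, and the homomorphisms it gives in both directions are completely contractive
and inverse to each other.

The direct sums defining the two algebras run over Hilbert spaces in a fixed universe. Larger
Hilbert spaces are orthogonal sums of closed invariant subspaces that are small enough to occur in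
these direct sums: the closed cyclic subspaces of the algebra generated by the operators and their
adjoints.
-/

universe t

noncomputable section

/-! ### Closed generated subalgebras -/

section ClosedGenerated

variable {R : Type*} [NonUnitalNormedRing R] [NormedSpace ℂ R] [IsScalarTower ℂ R R]
  [SMulCommClass ℂ R R]

theorem eq_top_of_subset_topologicalClosure_adjoin {s : Set R}
    {t : NonUnitalSubalgebra ℂ (NonUnitalAlgebra.adjoin ℂ s).topologicalClosure}
    (ht : IsClosed (t : Set (NonUnitalAlgebra.adjoin ℂ s).topologicalClosure))
    (hs : s ⊆ Subtype.val '' (t : Set (NonUnitalAlgebra.adjoin ℂ s).topologicalClosure)) :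
    t = ⊤ := by
  let A := (NonUnitalAlgebra.adjoin ℂ s).topologicalClosure
  have hclosed : IsClosed (t.map (NonUnitalSubalgebraClass.subtype A) : Set R) :=
    (NonUnitalSubalgebra.isClosed_topologicalClosure _).isClosedEmbedding_subtypeVal.isClosedMap
      _ ht
  have hle : A ≤ t.map (NonUnitalSubalgebraClass.subtype A) :=
    NonUnitalSubalgebra.topologicalClosure_minimal (NonUnitalAlgebra.adjoin_le hs) hclosed
  refine eq_top_iff.2 fun x _ => ?_
  obtain ⟨y, hy, hyx⟩ := hle x.2
  exact Subtype.ext hyx ▸ hy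

end ClosedGenerated

section Generators

variable {X : Type u} [TopologicalSpace X] {ι : Type} (τ : ι → C(X, X))

theorem semicrossedProduct.eq_top_of_isClosed {t : NonUnitalSubalgebra ℂ (semicrossedProduct τ)}
    (ht : IsClosed (t : Set (semicrossedProduct τ)))
    (hcoeff : ∀ f, semicrossedProduct.coeff τ f ∈ t)
    (hgen : ∀ i f, semicrossedProduct.gen τ i f ∈ t) : t = ⊤ := by
  refine eq_top_of_subset_topologicalClosure_adjoin ht (Set.union_subset ?_ ?_)
  · rintro _ ⟨f, rfl⟩
    exact ⟨_, hcoeff f, rfl⟩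
  · refine Set.iUnion_subset fun i => ?_
    rintro _ ⟨f, rfl⟩
    exact ⟨_, hgen i f, rfl⟩

variable {τ} in
theorem semicrossedProduct.hom_ext {B : Type*} [NonUnitalNonAssocSemiring B] [Module ℂ B]
    [TopologicalSpace B] [T2Space B] {φ ψ : semicrossedProduct τ →ₙₐ[ℂ] B}
    (hφ : Continuous φ) (hψ : Continuous ψ)
    (hcoeff : ∀ f, φ (semicrossedProduct.coeff τ f) = ψ (semicrossedProduct.coeff τ f))
    (hgen : ∀ i f, φ (semicrossedProduct.gen τ i f) = ψ (semicrossedProduct.gen τ i f)) :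
    φ = ψ := by
  have htop : NonUnitalAlgHom.equalizer φ ψ = ⊤ :=
    semicrossedProduct.eq_top_of_isClosed τ (isClosed_eq hφ hψ) hcoeff hgen
  exact NonUnitalAlgHom.ext fun x =>
    (htop ▸ NonUnitalAlgebra.mem_top : x ∈ NonUnitalAlgHom.equalizer φ ψ)

theorem semicrossedProduct.map_mem_of_isClosed {B : Type*} [NonUnitalNonAssocSemiring B]
    [Module ℂ B] [TopologicalSpace B] {φ : semicrossedProduct τ →ₙₐ[ℂ] B} (hφ : Continuous φ)
    {t : NonUnitalSubalgebra ℂ B} (ht : IsClosed (t : Set B))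
    (hcoeff : ∀ f, φ (semicrossedProduct.coeff τ f) ∈ t)
    (hgen : ∀ i f, φ (semicrossedProduct.gen τ i f) ∈ t) (x : semicrossedProduct τ) :
    φ x ∈ t := by
  have htop : t.comap φ = ⊤ :=
    semicrossedProduct.eq_top_of_isClosed τ (ht.preimage hφ) hcoeff hgen
  exact (htop ▸ NonUnitalAlgebra.mem_top : x ∈ t.comap φ)

variable {D : Type u} [NonUnitalRing D] [Module ℂ D]
variable {K : ι → Type v} [∀ i, NormedAddCommGroup (K i)] [∀ i, InnerProductSpace ℂ (K i)]
variable {A : ∀ i, NonUnitalSubalgebra ℂ (BOp (K i))} {δ : ∀ i, D →ₙₐ[ℂ] A i}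

theorem freeProduct.eq_top_of_isClosed
    {t : NonUnitalSubalgebra ℂ (freeProduct.{u, v, w} A δ)}
    (ht : IsClosed (t : Set (freeProduct.{u, v, w} A δ)))
    (hincl : ∀ i a, freeProduct.incl.{u, v, w} A δ i a ∈ t) : t = ⊤ := by
  refine eq_top_of_subset_topologicalClosure_adjoin ht (Set.iUnion_subset fun i => ?_)
  rintro _ ⟨a, rfl⟩
  exact ⟨_, hincl i a, rfl⟩

theorem freeProduct.hom_ext {B : Type*} [NonUnitalNonAssocSemiring B] [Module ℂ B]
    [TopologicalSpace B] [T2Space B] {φ ψ : freeProduct.{u, v, w} A δ →ₙₐ[ℂ] B}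
    (hφ : Continuous φ) (hψ : Continuous ψ)
    (hincl : ∀ i a, φ (freeProduct.incl A δ i a) = ψ (freeProduct.incl A δ i a)) : φ = ψ := by
  have htop : NonUnitalAlgHom.equalizer φ ψ = ⊤ :=
    freeProduct.eq_top_of_isClosed (isClosed_eq hφ hψ) hincl
  exact NonUnitalAlgHom.ext fun x =>
    (htop ▸ NonUnitalAlgebra.mem_top : x ∈ NonUnitalAlgHom.equalizer φ ψ)

theorem freeProduct.map_mem_of_isClosed {B : Type*} [NonUnitalNonAssocSemiring B]
    [Module ℂ B] [TopologicalSpace B] {φ : freeProduct.{u, v, w} A δ →ₙₐ[ℂ] B}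
    (hφ : Continuous φ) {t : NonUnitalSubalgebra ℂ B} (ht : IsClosed (t : Set B))
    (hincl : ∀ i a, φ (freeProduct.incl A δ i a) ∈ t) (x : freeProduct.{u, v, w} A δ) :
    φ x ∈ t := by
  have htop : t.comap φ = ⊤ := freeProduct.eq_top_of_isClosed (ht.preimage hφ) hincl
  exact (htop ▸ NonUnitalAlgebra.mem_top : x ∈ t.comap φ)

end Generators

/-! ### Matrix norms and completely contractive representations -/

section MatrixNorms

variable {K : Type*} [NormedAddCommGroup K] [InnerProductSpace ℂ K]
variable {H : Type*} [NormedAddCommGroup H] [InnerProductSpace ℂ H]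

@[simp]
theorem opMatrix_apply {k : ℕ} (M : Matrix (Fin k) (Fin k) (BOp K))
    (x : PiLp 2 (fun _ : Fin k => K)) (i : Fin k) : opMatrix M x i = ∑ j, M i j (x j) := by
  simp [opMatrix]

theorem norm_opMatrix_one (T : BOp K) : ‖opMatrix (k := 1) (fun _ _ => T)‖ = ‖T‖ := by
  refine le_antisymm (ContinuousLinearMap.opNorm_le_bound _ (norm_nonneg T) fun x => ?_)
    (norm_le_norm_opMatrix_one T)
  simpa [opMatrix, PiLp.norm_eq_of_L2] using T.le_opNorm (x 0)

omit [InnerProductSpace ℂ K] [InnerProductSpace ℂ H] in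
theorem norm_le_norm_of_forall_norm_coord_le {k : ℕ} {x : PiLp 2 (fun _ : Fin k => K)}
    {y : PiLp 2 (fun _ : Fin k => H)} (h : ∀ i, ‖x i‖ ≤ ‖y i‖) : ‖x‖ ≤ ‖y‖ := by
  rw [PiLp.norm_eq_of_L2, PiLp.norm_eq_of_L2]
  gcongr with i
  exact h i

theorem norm_opMatrix_compress_le {k : ℕ} (M : Matrix (Fin k) (Fin k) (BOp K))
    {P : K →L[ℂ] H} (hP : ‖P‖ ≤ 1) {V : H →L[ℂ] K} (hV : ‖V‖ ≤ 1) :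
    ‖opMatrix (M.map fun T => P ∘L T ∘L V)‖ ≤ ‖opMatrix M‖ := by
  refine ContinuousLinearMap.opNorm_le_bound _ (ContinuousLinearMap.opNorm_nonneg _) fun x => ?_
  set y : PiLp 2 (fun _ : Fin k => K) := WithLp.toLp 2 fun j => V (x j) with hy
  calc ‖opMatrix (M.map fun T => P ∘L T ∘L V) x‖ ≤ ‖opMatrix M y‖ :=
        norm_le_norm_of_forall_norm_coord_le fun i => by
          simpa [hy, map_sum] using P.le_of_opNorm_le hP (∑ j, M i j (V (x j)))
    _ ≤ ‖opMatrix M‖ * ‖y‖ := (opMatrix M).le_opNorm y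
    _ ≤ ‖opMatrix M‖ * ‖x‖ := by
        gcongr
        exact norm_le_norm_of_forall_norm_coord_le fun i => by
          simpa using V.le_of_opNorm_le hV (x i)

/-- Completely contractive representations of an operator algebra on a Hilbert space: the condition
`AmalgamatedRep.contractive`. Unlike `CompletelyContractive`, it does not refer to a subalgebra of
the target. -/
def IsCompletelyContractiveRep {A : NonUnitalSubalgebra ℂ (BOp K)} (π : A →ₙₐ[ℂ] BOp H) : Prop :=
  ∀ (k : ℕ) (M : Matrix (Fin k) (Fin k) A), ‖opMatrix (M.map π)‖ ≤ matNorm A M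

variable {A : NonUnitalSubalgebra ℂ (BOp K)} {B : NonUnitalSubalgebra ℂ (BOp H)}

namespace IsCompletelyContractiveRep

variable {π : A →ₙₐ[ℂ] BOp H}

theorem norm_apply_le (hπ : IsCompletelyContractiveRep π) (a : A) : ‖π a‖ ≤ ‖a‖ :=
  calc ‖π a‖ = ‖opMatrix (k := 1) fun _ _ => π a‖ := (norm_opMatrix_one _).symm
    _ ≤ matNorm A (k := 1) fun _ _ => a := hπ 1 _
    _ = ‖a‖ := norm_opMatrix_one (a : BOp K)

theorem exists_norm_apply_le {J : Type*} {E : J → Type*} [∀ j, NormedAddCommGroup (E j)]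
    [∀ j, InnerProductSpace ℂ (E j)] {π : ∀ j, A →ₙₐ[ℂ] BOp (E j)}
    (hπ : ∀ j, IsCompletelyContractiveRep (π j)) (a : A) : ∃ C, ∀ j, ‖π j a‖ ≤ C :=
  ⟨‖a‖, fun j => (hπ j).norm_apply_le a⟩

protected theorem continuous (hπ : IsCompletelyContractiveRep π) : Continuous π :=
  AddMonoidHomClass.continuous_of_bound π 1 fun a => (hπ.norm_apply_le a).trans_eq (one_mul _).symm

theorem codRestrict (hπ : IsCompletelyContractiveRep π) (h : ∀ a, π a ∈ B) :
    CompletelyContractive (NonUnitalAlgHom.codRestrict π B h) :=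
  hπ

end IsCompletelyContractiveRep

namespace CompletelyContractive

variable {φ : A →ₙₐ[ℂ] B} {ψ : B →ₙₐ[ℂ] A}

theorem subtype_comp (hφ : CompletelyContractive φ) :
    IsCompletelyContractiveRep ((NonUnitalSubalgebraClass.subtype B).comp φ) :=
  hφ

protected theorem continuous (hφ : CompletelyContractive φ) : Continuous φ :=
  hφ.subtype_comp.continuous.subtype_mk _

theorem completelyIsometric_of_leftInverse (hφ : CompletelyContractive φ)
    (hψ : CompletelyContractive ψ) (h : Function.LeftInverse ψ φ) : CompletelyIsometric φ :=
  fun k M => le_antisymm (hφ k M) <| by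
    simpa [Matrix.map_map, h.comp_eq_id] using hψ k (M.map φ)

end CompletelyContractive

end MatrixNorms

/-! ### Diagonal operators on direct sums -/

section Diagonal

variable {J : Type v} (E : J → Type u) [∀ j, NormedAddCommGroup (E j)]
  [∀ j, InnerProductSpace ℂ (E j)]

open Classical in
/-- The projection of a direct sum of Hilbert spaces onto the summand `E j`. -/
def summandProjection (j : J) : BOp (lp E 2) :=
  lp.singleContinuousLinearMap ℂ E 2 j ∘L lp.evalCLM ℂ E 2 j

/-- The algebra of the operators on a direct sum of Hilbert spaces that are direct sums of
operators, encoded as the commutant of the projections onto the summands. -/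
def diagonalAlgebra : NonUnitalSubalgebra ℂ (BOp (lp E 2)) :=
  NonUnitalSubalgebra.centralizer ℂ (Set.range (summandProjection E))

theorem isClosed_diagonalAlgebra : IsClosed (diagonalAlgebra E : Set (BOp (lp E 2))) :=
  Set.isClosed_centralizer _

variable {E}

open Classical in
theorem summandProjection_apply (j : J) (x : lp E 2) :
    summandProjection E j x = lp.single 2 j (x j) :=
  rfl

open Classical in
/-- The compression of an operator on a direct sum of Hilbert spaces to the summand `E j`. -/
def compression (j : J) (T : BOp (lp E 2)) : BOp (E j) :=
  lp.evalCLM ℂ E 2 j ∘L T ∘L lp.singleContinuousLinearMap ℂ E 2 j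

open Classical in
theorem compression_apply (j : J) (T : BOp (lp E 2)) (x : E j) :
    compression j T x = T (lp.single 2 j x) j :=
  rfl

theorem apply_coord_of_mem_diagonalAlgebra {T : BOp (lp E 2)} (hT : T ∈ diagonalAlgebra E)
    (x : lp E 2) (j : J) : T x j = compression j T (x j) := by
  have hcomm := DFunLike.congr_fun ((NonUnitalSubalgebra.mem_centralizer_iff ℂ).1 hT _ ⟨j, rfl⟩) x
  simpa [summandProjection_apply, compression_apply] using congr_arg (fun y : lp E 2 => y j) hcomm

theorem mem_diagonalAlgebra_of_apply_coord {T : BOp (lp E 2)} {S : ∀ j, BOp (E j)}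
    (h : ∀ x j, T x j = S j (x j)) : T ∈ diagonalAlgebra E := by
  classical
  rw [diagonalAlgebra, NonUnitalSubalgebra.mem_centralizer_iff]
  rintro _ ⟨j, rfl⟩
  ext x i
  obtain rfl | hij := eq_or_ne i j
  · simp [summandProjection_apply, h]
  · simp [summandProjection_apply, h, hij]

theorem compression_eq_of_apply_coord {T : BOp (lp E 2)} {j : J} {S : BOp (E j)}
    (h : ∀ x, T x j = S (x j)) : compression j T = S := by
  ext x
  simp [compression_apply, h]

theorem norm_opMatrix_compression_le {k : ℕ} (M : Matrix (Fin k) (Fin k) (BOp (lp E 2))) (j : J) :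
    ‖opMatrix (M.map (compression j))‖ ≤ ‖opMatrix M‖ := by
  classical
  refine norm_opMatrix_compress_le M ?_ ?_
  · exact ContinuousLinearMap.opNorm_le_bound _ zero_le_one fun x =>
      (lp.norm_apply_le_norm (by simp) x j).trans_eq (one_mul _).symm
  · exact ContinuousLinearMap.opNorm_le_bound _ zero_le_one fun x =>
      ((lp.norm_single (by simp) j x).trans (one_mul _).symm).le

omit [∀ j, InnerProductSpace ℂ (E j)] in
theorem hasSum_sq_norm_coord {k : ℕ} (x : PiLp 2 (fun _ : Fin k => lp E 2)) :
    HasSum (fun j => ‖(WithLp.toLp 2 fun i => x i j : PiLp 2 fun _ : Fin k => E j)‖ ^ 2)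
      (‖x‖ ^ 2) := by
  simp only [PiLp.norm_sq_eq_of_L2]
  exact hasSum_sum fun i _ => by simpa using lp.hasSum_norm (p := 2) (by simp) (x i)

theorem norm_opMatrix_le_of_compression_le {k : ℕ} {M : Matrix (Fin k) (Fin k) (BOp (lp E 2))}
    (hM : ∀ i j, M i j ∈ diagonalAlgebra E) {C : ℝ} (hC : 0 ≤ C)
    (h : ∀ j, ‖opMatrix (M.map (compression j))‖ ≤ C) : ‖opMatrix M‖ ≤ C := by
  refine ContinuousLinearMap.opNorm_le_bound _ hC fun x => ?_
  refine le_of_sq_le_sq ?_ (by positivity)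
  rw [mul_pow]
  refine hasSum_le (fun j => ?_) (hasSum_sq_norm_coord (opMatrix M x))
    ((hasSum_sq_norm_coord x).mul_left (C ^ 2))
  have hcoord : (WithLp.toLp 2 fun i => opMatrix M x i j : PiLp 2 fun _ : Fin k => E j) =
      opMatrix (M.map (compression j)) (WithLp.toLp 2 fun i => x i j) := by
    ext i
    simp only [opMatrix_apply, Matrix.map_apply, ← apply_coord_of_mem_diagonalAlgebra (hM i _)]
    rw [lp.coeFn_sum, Finset.sum_apply]
  rw [hcoord, ← mul_pow]
  gcongr
  exact ContinuousLinearMap.le_of_opNorm_le _ (h j) _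

variable {A : NonUnitalSubalgebra ℂ (BOp (lp E 2))}

/-- The representation of an algebra of diagonal operators on the summand `E j`. -/
def summandRep (hA : A ≤ diagonalAlgebra E) (j : J) : A →ₙₐ[ℂ] BOp (E j) where
  toFun a := compression j a
  map_smul' c a := by ext; simp [compression_apply]
  map_zero' := by ext; simp [compression_apply]
  map_add' a b := by ext; simp [compression_apply]
  map_mul' a b := by
    ext x
    exact apply_coord_of_mem_diagonalAlgebra (hA a.2) _ j

theorem isCompletelyContractiveRep_summandRep (hA : A ≤ diagonalAlgebra E) (j : J) :
    IsCompletelyContractiveRep (summandRep hA j) :=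
  fun _ M => norm_opMatrix_compression_le (M.map Subtype.val) j

theorem matNorm_le_of_summandRep_le (hA : A ≤ diagonalAlgebra E) {k : ℕ}
    {M : Matrix (Fin k) (Fin k) A} {C : ℝ} (hC : 0 ≤ C)
    (h : ∀ j, ‖opMatrix (M.map (summandRep hA j))‖ ≤ C) : matNorm A M ≤ C :=
  norm_opMatrix_le_of_compression_le (fun i j => hA (M i j).2) hC h

theorem isCompletelyContractiveRep_directSumRep {K : Type*} [NormedAddCommGroup K]
    [InnerProductSpace ℂ K] {B : NonUnitalSubalgebra ℂ (BOp K)} {π : ∀ j, B →ₙₐ[ℂ] BOp (E j)}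
    (hπ : ∀ j, IsCompletelyContractiveRep (π j)) (hb : ∀ b, ∃ C, ∀ j, ‖π j b‖ ≤ C) :
    IsCompletelyContractiveRep (directSumRep π hb) := fun k M => by
  refine norm_opMatrix_le_of_compression_le (M := M.map (directSumRep π hb))
    (fun i j => mem_diagonalAlgebra_of_apply_coord (S := fun l => π l (M i j)) fun _ _ => rfl)
    (ContinuousLinearMap.opNorm_nonneg _) fun j => ?_
  have hcomp : (M.map (directSumRep π hb)).map (compression j) = M.map (π j) := by
    ext1 i l
    exact compression_eq_of_apply_coord fun _ => rfl
  exact hcomp ▸ hπ j k M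

end Diagonal

/-! ### Decomposition into small invariant subspaces -/

section Decomposition

open scoped lp InnerProductSpace

theorem small_closure {α : Type*} [TopologicalSpace α] [FrechetUrysohnSpace α] [T2Space α]
    (s : Set α) [Small.{w} s] : Small.{w} (closure s) := by
  choose a ha using fun x : closure s => mem_closure_iff_seq_limit.1 x.2
  refine small_of_injective (f := fun x n => (⟨a x n, (ha x).1 n⟩ : s)) fun x y hxy => ?_
  have hseq : a x = a y := funext fun n => congr_arg Subtype.val (congr_fun hxy n)
  exact Subtype.ext (tendsto_nhds_unique (ha x).2 (hseq ▸ (ha y).2))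

theorem small_algebra_adjoin {R A : Type*} [CommSemiring R] [Semiring A] [Algebra R A]
    [Small.{w} R] (s : Set A) [Small.{w} s] : Small.{w} (Algebra.adjoin R s) := by
  have hfree : Small.{w} (FreeMonoid s) := inferInstanceAs (Small.{w} (List s))
  have hmonoid : Small.{w} (Submonoid.closure s : Set A) := by
    rw [Submonoid.closure_eq_mrange]
    exact small_range _
  have hspan := Submodule.small_span (R := R) (Submonoid.closure s : Set A)
  rwa [← Algebra.adjoin_eq_span] at hspan

variable {H : Type v} [NormedAddCommGroup H] [InnerProductSpace ℂ H]

/-- The closed, `w`-small subspaces that are invariant under a set of operators. -/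
structure IsSmallInvariant (S : Set (BOp H)) (M : Submodule ℂ H) : Prop where
  isClosed : IsClosed (M : Set H)
  small : Small.{w} M
  mapsTo : ∀ T ∈ S, Set.MapsTo T M M

/-- The closed cyclic subspace of the algebra generated by `S` and the identity. -/
def cyclicSubspace (S : Set (BOp H)) (x : H) : Submodule ℂ H :=
  ((Algebra.adjoin ℂ S).toSubmodule.map
    (ContinuousLinearMap.apply ℂ H x).toLinearMap).topologicalClosure

theorem mem_cyclicSubspace_self (S : Set (BOp H)) (x : H) : x ∈ cyclicSubspace S x :=
  Submodule.le_topologicalClosure _ ⟨1, one_mem (Algebra.adjoin ℂ S), rfl⟩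

theorem isSmallInvariant_cyclicSubspace (S : Set (BOp H)) [Small.{w} S] (x : H) :
    IsSmallInvariant.{v, w} S (cyclicSubspace S x) where
  isClosed := Submodule.isClosed_topologicalClosure _
  small :=
    have := small_algebra_adjoin.{w} (R := ℂ) S
    have : Small.{w} ((fun T : BOp H => T x) '' (Algebra.adjoin ℂ S : Set (BOp H))) :=
      small_image _ _
    small_closure ((fun T : BOp H => T x) '' (Algebra.adjoin ℂ S : Set (BOp H)))
  mapsTo T hT := by
    refine Set.MapsTo.closure ?_ T.continuous
    rintro _ ⟨U, hU, rfl⟩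
    exact ⟨T * U, (Algebra.adjoin ℂ S).mul_mem (Algebra.subset_adjoin hT) hU, rfl⟩

theorem cyclicSubspace_le {S : Set (BOp H)} {M : Submodule ℂ H} (hM : IsClosed (M : Set H))
    (hS : ∀ T ∈ S, Set.MapsTo T M M) {x : H} (hx : x ∈ M) : cyclicSubspace S x ≤ M := by
  refine Submodule.topologicalClosure_minimal _ ?_ hM
  rintro _ ⟨U, hU, rfl⟩
  suffices ∀ y ∈ M, U y ∈ M from this x hx
  induction hU using Algebra.adjoin_induction with
  | mem _ hT => exact hS _ hT
  | algebraMap c => exact fun y hy => M.smul_mem c hy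
  | add _ _ _ _ hT hU => exact fun y hy => M.add_mem (hT y hy) (hU y hy)
  | mul _ _ _ _ hT hU => exact fun y hy => hT _ (hU y hy)

theorem mapsTo_orthogonal [CompleteSpace H] {M : Submodule ℂ H} {T : BOp H}
    (hT : Set.MapsTo (star T : BOp H) M M) : Set.MapsTo T Mᗮ Mᗮ := fun x hx y hy => by
  rw [← ContinuousLinearMap.adjoint_inner_left]
  exact hx _ (hT hy)

theorem exists_maximal_orthogonal_isSmallInvariant (S : Set (BOp H)) :
    ∃ F : Set (Submodule ℂ H), Maximal (fun F : Set (Submodule ℂ H) =>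
      (∀ M ∈ F, IsSmallInvariant.{v, w} S M) ∧ F.Pairwise (· ⟂ ·)) F := by
  refine zorn_subset {F | _} fun c hc hchain => ⟨⋃₀ c, ⟨?_, ?_⟩, fun _ => Set.subset_sUnion_of_mem⟩
  · rintro M ⟨F, hF, hM⟩
    exact (hc hF).1 M hM
  · exact (Set.pairwise_sUnion hchain.directedOn).2 fun F hF => (hc hF).2

variable [CompleteSpace H]

theorem exists_orthogonal_isSmallInvariant_sSup_dense (S : Set (BOp H)) [Small.{w} S]
    (hS : ∀ T ∈ S, star T ∈ S) : ∃ F : Set (Submodule ℂ H),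
      (∀ M ∈ F, IsSmallInvariant.{v, w} S M) ∧ F.Pairwise (· ⟂ ·) ∧
        (sSup F).topologicalClosure = ⊤ := by
  obtain ⟨F, ⟨hinv, hpair⟩, hmax⟩ := exists_maximal_orthogonal_isSmallInvariant.{v, w} S
  refine ⟨F, hinv, hpair, ?_⟩
  rw [Submodule.topologicalClosure_eq_top_iff, Submodule.eq_bot_iff]
  intro x hx
  have hcyclic : cyclicSubspace S x ≤ (sSup F)ᗮ := by
    refine cyclicSubspace_le (Submodule.isClosed_orthogonal _) (fun T hT => ?_) hx
    refine mapsTo_orthogonal fun y hy => ?_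
    have : sSup F ≤ (sSup F).comap (star T : BOp H).toLinearMap :=
      sSup_le fun M hM z hz => le_sSup hM ((hinv M hM).mapsTo _ (hS T hT) hz)
    exact this hy
  have horth : ∀ M ∈ F, cyclicSubspace S x ⟂ M := fun M hM =>
    hcyclic.trans (Submodule.orthogonal_le (le_sSup hM))
  have hmem : cyclicSubspace S x ∈ F := by
    refine hmax ⟨?_, ?_⟩ (Set.subset_insert (cyclicSubspace S x) F) (Set.mem_insert _ F)
    · exact Set.forall_mem_insert.2 ⟨isSmallInvariant_cyclicSubspace S x, hinv⟩
    · exact hpair.insert fun M hM _ => ⟨horth M hM, (horth M hM).symm⟩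
  exact inner_self_eq_zero.1 (hx x (le_sSup hmem (mem_cyclicSubspace_self S x)))

theorem exists_linearIsometry_lp_range_eq (M : Submodule ℂ H) (hM : IsClosed (M : Set H))
    [Small.{w} M] : ∃ (κ : Type w) (V : ℓ²(κ, ℂ) →ₗᵢ[ℂ] H), V.range = M := by
  have : CompleteSpace M := hM.completeSpace_coe
  obtain ⟨b, B, -⟩ := exists_hilbertBasis ℂ M
  let e := equivShrink.{w} b
  let B' : HilbertBasis (Shrink.{w} b) ℂ M := HilbertBasis.mk (v := B ∘ e.symm)
    (B.orthonormal.comp _ e.symm.injective) <| by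
      rw [e.symm.surjective.range_comp]
      exact B.dense_span.ge
  refine ⟨Shrink.{w} b, M.subtypeₗᵢ.comp B'.repr.symm.toLinearIsometry, ?_⟩
  ext x
  constructor
  · rintro ⟨y, rfl⟩
    exact (B'.repr.symm y).2
  · exact fun hx => ⟨B'.repr ⟨x, hx⟩, by simp⟩

theorem exists_isHilbertSum_lp_mapsTo_range (S : Set (BOp H)) [Small.{w} S]
    (hS : ∀ T ∈ S, star T ∈ S) :
    ∃ (J : Type v) (κ : J → Type w) (V : ∀ j, ℓ²(κ j, ℂ) →ₗᵢ[ℂ] H), IsHilbertSum ℂ _ V ∧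
      ∀ T ∈ S, ∀ j, Set.MapsTo T (V j).range (V j).range := by
  obtain ⟨F, hinv, hpair, hdense⟩ := exists_orthogonal_isSmallInvariant_sSup_dense.{v, w} S hS
  have hsmall : ∀ M : F, Small.{w} M.1 := fun M => (hinv M M.2).small
  choose κ V hV using fun M : F =>
    exists_linearIsometry_lp_range_eq.{v, w} M.1 (hinv M M.2).isClosed
  refine ⟨F, κ, V, IsHilbertSum.mk (fun M N hMN x y => ?_) ?_, fun T hT M => ?_⟩
  · have horth : (V M).range ⟂ (V N).range := by
      rw [hV, hV]
      exact hpair M.2 N.2 (Subtype.coe_ne_coe.2 hMN)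
    exact horth.inner_eq ⟨x, rfl⟩ ⟨y, rfl⟩
  · rw [← hdense, sSup_eq_iSup']
    simp only [← hV]
    exact le_rfl
  · simpa only [hV] using (hinv M M.2).mapsTo T hT

end Decomposition

/-! ### Contractive representations of C⋆-algebras -/

section ContractiveRep

variable {A : Type*} [NonUnitalCStarAlgebra A]
variable {H : Type*} [NormedAddCommGroup H] [InnerProductSpace ℂ H]

theorem one_add_I_mul_ne_zero {z : ℂ} (hz : z.im = 0) : 1 + Complex.I * z ≠ 0 := fun h => by
  simpa [hz] using congr_arg Complex.re h

theorem norm_I_mul_div_one_add_I_mul_le_one {z : ℂ} (hz : z.im = 0) :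
    ‖Complex.I * z / (1 + Complex.I * z)‖ ≤ 1 := by
  rw [norm_div]
  refine div_le_one_of_le₀ ?_ (norm_nonneg _)
  rw [← sq_le_sq₀ (norm_nonneg _) (norm_nonneg _), Complex.sq_norm, Complex.sq_norm,
    Complex.normSq_apply, Complex.normSq_apply]
  simp [hz]

-- The element is `a = i h / (1 + i h)`.
theorem exists_norm_le_one_I_smul_eq_add_mul {h : A} (hh : IsSelfAdjoint h) :
    ∃ a : A, ‖a‖ ≤ 1 ∧ Complex.I • h = a + a * (Complex.I • h) := by
  have him : ∀ z ∈ quasispectrum ℂ h, z.im = 0 := fun z hz => by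
    simpa using congr_arg Complex.im (hh.quasispectrumRestricts.rightInvOn hz).symm
  have hcont : ContinuousOn (fun z => Complex.I * z / (1 + Complex.I * z)) (quasispectrum ℂ h) :=
    ContinuousOn.div (by fun_prop) (by fun_prop) fun z hz => one_add_I_mul_ne_zero (him z hz)
  have hI : Complex.I • h = cfcₙ (fun z : ℂ => Complex.I * z) h :=
    (cfcₙ_const_mul_id Complex.I h).symm
  refine ⟨cfcₙ (fun z => Complex.I * z / (1 + Complex.I * z)) h, norm_cfcₙ_le fun z hz =>
    norm_I_mul_div_one_add_I_mul_le_one (him z hz), ?_⟩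
  rw [hI, ← cfcₙ_mul _ _ h, ← cfcₙ_add _ _ h]
  refine cfcₙ_congr fun z hz => ?_
  have := one_add_I_mul_ne_zero (him z hz)
  field_simp

/-- If `a = i h / (1 + i h)`, then `ρ (i h) ξ = ρ a (ξ + ρ (i h) ξ)`. -/
theorem norm_I_smul_map_le {ρ : A →ₙₐ[ℂ] BOp H} (hρ : ∀ a, ‖ρ a‖ ≤ ‖a‖) {h : A}
    (hh : IsSelfAdjoint h) (ξ : H) : ‖Complex.I • ρ h ξ‖ ≤ ‖ξ + Complex.I • ρ h ξ‖ := by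
  obtain ⟨a, ha, hcayley⟩ := exists_norm_le_one_I_smul_eq_add_mul hh
  have hη : Complex.I • ρ h ξ = ρ a (ξ + Complex.I • ρ h ξ) := by
    simpa using congr_arg (fun b => ρ b ξ) hcayley
  calc ‖Complex.I • ρ h ξ‖ = ‖ρ a (ξ + Complex.I • ρ h ξ)‖ := by rw [← hη]
    _ ≤ 1 * ‖ξ + Complex.I • ρ h ξ‖ := (ρ a).le_of_opNorm_le ((hρ a).trans ha) _
    _ = ‖ξ + Complex.I • ρ h ξ‖ := one_mul _

theorem im_inner_map_self_eq_zero {ρ : A →ₙₐ[ℂ] BOp H} (hρ : ∀ a, ‖ρ a‖ ≤ ‖a‖) {h : A}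
    (hh : IsSelfAdjoint h) (ξ : H) : (inner ℂ ξ (ρ h ξ)).im = 0 := by
  set c := (inner ℂ ξ (ρ h ξ)).im with hc
  have hlin : ∀ t : ℝ, 2 * t * c ≤ ‖ξ‖ ^ 2 := fun t => by
    have ht : IsSelfAdjoint (t : ℂ) := Complex.conj_ofReal t
    have hle := norm_I_smul_map_le hρ (ht.smul hh) ξ
    have hsq : ‖Complex.I • ρ ((t : ℂ) • h) ξ‖ ^ 2 ≤ ‖ξ + Complex.I • ρ ((t : ℂ) • h) ξ‖ ^ 2 := by
      gcongr
    have hre : RCLike.re (inner ℂ ξ (Complex.I • ρ ((t : ℂ) • h) ξ)) = -(t * c) := by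
      rw [map_smul]
      simp [hc]
    rw [norm_add_sq (𝕜 := ℂ), hre] at hsq
    linarith
  by_contra hne
  have hcontra := hlin ((‖ξ‖ ^ 2 + 1) / (2 * c))
  field_simp at hcontra
  linarith

theorem map_star_of_norm_map_le [CompleteSpace H] {ρ : A →ₙₐ[ℂ] BOp H}
    (hρ : ∀ a, ‖ρ a‖ ≤ ‖a‖) (a : A) : ρ (star a) = star (ρ a) := by
  have hsa : ∀ h : A, IsSelfAdjoint h → IsSelfAdjoint (ρ h) := fun h hh => by
    rw [ContinuousLinearMap.isSelfAdjoint_iff_isSymmetric,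
      LinearMap.isSymmetric_iff_inner_map_self_real]
    intro ξ
    rw [Complex.conj_eq_iff_im, ContinuousLinearMap.coe_coe, ← inner_conj_symm, Complex.conj_im,
      im_inner_map_self_eq_zero hρ hh ξ, neg_zero]
  have hre := hsa _ (realPart a).2
  have him := hsa _ (imaginaryPart a).2
  rw [← realPart_add_I_smul_imaginaryPart a]
  simp only [star_add, star_smul, map_add, map_smul, hre.star_eq, him.star_eq,
    (realPart a).2.star_eq, (imaginaryPart a).2.star_eq]

/-! ### Contractive module maps -/

theorem exists_contraction_comp_eq [CompleteSpace H] {V : Type*} [AddCommGroup V] [Module ℂ V]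
    {L L' : V →ₗ[ℂ] H} (h : ∀ z, ‖L' z‖ ≤ ‖L z‖) : ∃ S : BOp H, ‖S‖ ≤ 1 ∧ ∀ z, S (L z) = L' z := by
  let M := (LinearMap.range L).topologicalClosure
  have : CompleteSpace M :=
    (Submodule.isClosed_topologicalClosure (LinearMap.range L)).completeSpace_coe
  let e : V →ₗ[ℂ] M := L.codRestrict M fun z =>
    Submodule.le_topologicalClosure _ (LinearMap.mem_range_self L z)
  have he : DenseRange e := fun x => by
    rw [closure_subtype, ← Set.range_comp]
    exact x.2
  have hle : ∀ z, ‖L' z‖ ≤ 1 * ‖e z‖ := fun z => by rw [one_mul]; exact h z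
  refine ⟨(L'.extendOfNorm e) ∘L M.orthogonalProjectionOnto, ?_, fun z => ?_⟩
  · refine (ContinuousLinearMap.opNorm_comp_le _ _).trans ?_
    exact mul_le_one₀ (LinearMap.opNorm_extendOfNorm_le he zero_le_one hle) (norm_nonneg _)
      (Submodule.orthogonalProjectionOnto_norm_le M)
  · rw [ContinuousLinearMap.comp_apply,
      show M.orthogonalProjectionOnto (L z) = e z from
        Submodule.orthogonalProjectionOnto_mem_subspace_eq_self (e z),
      LinearMap.extendOfNorm_eq he ⟨1, hle⟩]

open TensorProduct in
/-- The linear map `a ⊗ ξ ↦ s a ξ`. -/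
def actionMap (s : A →ₗ[ℂ] BOp H) : A ⊗[ℂ] H →ₗ[ℂ] H :=
  TensorProduct.lift ((ContinuousLinearMap.coeLM ℂ) ∘ₗ s)

open TensorProduct in
/-- For an approximate unit `e`, the operator `s e` maps `∑ π (a j) (ξ j)` to `∑ s (e * a j) (ξ j)`,
which converges to `∑ s (a j) (ξ j)`. -/
theorem norm_actionMap_le {π : A →ₙₐ[ℂ] BOp H} {s : A →ₗ[ℂ] BOp H} (hs : ∀ a, ‖s a‖ ≤ ‖a‖)
    (hmul : ∀ a b, s (a * b) = s a * π b) (z : A ⊗[ℂ] H) :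
    ‖actionMap s z‖ ≤ ‖actionMap (π : A →ₗ[ℂ] BOp H) z‖ := by
  let _ : PartialOrder A := CStarAlgebra.spectralOrder A
  have : StarOrderedRing A := CStarAlgebra.spectralOrderedRing A
  have hl := CStarAlgebra.increasingApproximateUnit A
  have hcont : Continuous s := AddMonoidHomClass.continuous_of_bound s 1 (by simpa using hs)
  have hlim : Filter.Tendsto (fun e => s e (actionMap (π : A →ₗ[ℂ] BOp H) z))
      (CStarAlgebra.approximateUnit A) (nhds (actionMap s z)) := by
    induction z using TensorProduct.induction_on with
    | zero => simp
    | add z z' hz hz' => simpa only [map_add] using hz.add hz'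
    | tmul a ξ =>
      have hact : ∀ e, s e (π a ξ) = s (e * a) ξ := fun e => by simp [hmul]
      simp only [actionMap, TensorProduct.lift.tmul, LinearMap.comp_apply]
      have hsa : Filter.Tendsto (fun e => s (e * a)) (CStarAlgebra.approximateUnit A)
          (nhds (s a)) := (hcont.tendsto a).comp (hl.tendsto_mul_right a)
      simpa [hact, Function.comp_def] using
        ((ContinuousLinearMap.apply ℂ H ξ).continuous.tendsto _).comp hsa
  have := hl.neBot
  refine le_of_tendsto hlim.norm (hl.eventually_norm.mono fun e he => ?_)
  simpa using (s e).le_of_opNorm_le ((hs e).trans he) (actionMap (π : A →ₗ[ℂ] BOp H) z)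

theorem exists_contraction_mul_eq [CompleteSpace H] {π : A →ₙₐ[ℂ] BOp H}
    {s : A →ₗ[ℂ] BOp H} (hs : ∀ a, ‖s a‖ ≤ ‖a‖) (hmul : ∀ a b, s (a * b) = s a * π b) :
    ∃ S : BOp H, ‖S‖ ≤ 1 ∧ ∀ a, s a = S * π a := by
  obtain ⟨S, hS, hSL⟩ := exists_contraction_comp_eq (norm_actionMap_le hs hmul)
  refine ⟨S, hS, fun a => ContinuousLinearMap.ext fun ξ => ?_⟩
  simpa [actionMap] using (hSL (a ⊗ₜ[ℂ] ξ)).symm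

end ContractiveRep

/-! ### Compressions to invariant subspaces -/

section Compression

open ContinuousLinearMap

variable {H : Type*} [NormedAddCommGroup H] [InnerProductSpace ℂ H] [CompleteSpace H]
variable {L : Type*} [NormedAddCommGroup L] [InnerProductSpace ℂ L] [CompleteSpace L]

theorem adjoint_linearIsometry_apply_self (V : L →ₗᵢ[ℂ] H) (x : L) :
    adjoint V.toContinuousLinearMap (V x) = x :=
  ext_inner_right ℂ fun y => by simp [adjoint_inner_left]

theorem linearIsometry_adjoint_apply_of_mem_range {V : L →ₗᵢ[ℂ] H} {y : H} (hy : y ∈ V.range) :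
    V (adjoint V.toContinuousLinearMap y) = y := by
  obtain ⟨x, rfl⟩ := hy
  exact congr_arg V (adjoint_linearIsometry_apply_self V x)

/-- The restriction of a representation to an invariant subspace, which is given as the range of
an isometry `V` in order to move it to another Hilbert space. -/
def restrictRep {B : Type*} [NonUnitalRing B] [Module ℂ B] (π : B →ₙₐ[ℂ] BOp H)
    (V : L →ₗᵢ[ℂ] H) (hV : ∀ b, Set.MapsTo (π b) V.range V.range) : B →ₙₐ[ℂ] BOp L where
  toFun b := adjoint V.toContinuousLinearMap ∘L π b ∘L V.toContinuousLinearMap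
  map_smul' c b := by ext; simp
  map_zero' := by ext; simp
  map_add' a b := by ext; simp
  map_mul' a b := by
    ext x
    have hb : V (adjoint V.toContinuousLinearMap (π b (V x))) = π b (V x) :=
      linearIsometry_adjoint_apply_of_mem_range (hV b ⟨x, rfl⟩)
    simp [hb]

theorem linearIsometry_restrictRep_apply {B : Type*} [NonUnitalRing B] [Module ℂ B]
    {π : B →ₙₐ[ℂ] BOp H} {V : L →ₗᵢ[ℂ] H} (hV : ∀ b, Set.MapsTo (π b) V.range V.range) (b : B)
    (x : L) : V (restrictRep π V hV b x) = π b (V x) :=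
  linearIsometry_adjoint_apply_of_mem_range (hV b ⟨x, rfl⟩)

theorem IsCompletelyContractiveRep.restrictRep {K : Type*} [NormedAddCommGroup K]
    [InnerProductSpace ℂ K] {A : NonUnitalSubalgebra ℂ (BOp K)} {π : A →ₙₐ[ℂ] BOp H}
    (hπ : IsCompletelyContractiveRep π) {V : L →ₗᵢ[ℂ] H}
    (hV : ∀ a, Set.MapsTo (π a) V.range V.range) :
    IsCompletelyContractiveRep (restrictRep π V hV) := fun k M =>
  (norm_opMatrix_compress_le (M.map π)
    ((adjoint.norm_map V.toContinuousLinearMap).trans_le V.norm_toContinuousLinearMap_le)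
    V.norm_toContinuousLinearMap_le).trans (hπ k M)

end Compression

/-! ### Free products with amalgamation -/

section FreeProduct

variable {ι : Type} {D : Type u} [NonUnitalRing D] [Module ℂ D]
variable {K : ι → Type v} [∀ i, NormedAddCommGroup (K i)] [∀ i, InnerProductSpace ℂ (K i)]
variable {A : ∀ i, NonUnitalSubalgebra ℂ (BOp (K i))} {δ : ∀ i, D →ₙₐ[ℂ] A i}

theorem isCompletelyContractiveRep_freeRep (i : ι) :
    IsCompletelyContractiveRep (freeRep.{u, v, w} A δ i) :=
  isCompletelyContractiveRep_directSumRep (fun Q => Q.contractive i) _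

theorem freeProduct.completelyContractive_incl (i : ι) :
    CompletelyContractive (freeProduct.incl.{u, v, w} A δ i) :=
  (isCompletelyContractiveRep_freeRep i).codRestrict (freeRep_mem A δ i)

theorem freeProduct.le_diagonalAlgebra : freeProduct.{u, v, w} A δ ≤ diagonalAlgebra _ := by
  refine NonUnitalSubalgebra.topologicalClosure_minimal (NonUnitalAlgebra.adjoin_le ?_)
    (isClosed_diagonalAlgebra _)
  refine Set.iUnion_subset fun i => ?_
  rintro _ ⟨a, rfl⟩
  exact mem_diagonalAlgebra_of_apply_coord (S := fun Q : AmalgamatedRep A δ => Q.π i a)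
    fun _ _ => rfl

theorem freeProduct.incl_amalgam (i j : ι) (d : D) :
    freeProduct.incl.{u, v, w} A δ i (δ i d) = freeProduct.incl A δ j (δ j d) := by
  refine Subtype.ext (ContinuousLinearMap.ext fun x => ?_)
  ext Q
  exact DFunLike.congr_fun (Q.agree i j d) (x Q)

namespace AmalgamatedRep

/-- The representation of the free product on a summand of its Hilbert space. -/
def freeProductRep (Q : AmalgamatedRep.{u, v, w} A δ) :
    freeProduct.{u, v, w} A δ →ₙₐ[ℂ] BOp Q.H :=
  summandRep freeProduct.le_diagonalAlgebra Q

@[simp]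
theorem freeProductRep_incl (Q : AmalgamatedRep.{u, v, w} A δ) (i : ι) (a : A i) :
    Q.freeProductRep (freeProduct.incl A δ i a) = Q.π i a :=
  compression_eq_of_apply_coord fun _ => rfl

theorem isCompletelyContractiveRep_freeProductRep (Q : AmalgamatedRep.{u, v, w} A δ) :
    IsCompletelyContractiveRep Q.freeProductRep :=
  isCompletelyContractiveRep_summandRep _ Q

theorem norm_opMatrix_map_le_matNorm_incl (Q : AmalgamatedRep.{u, v, w} A δ) (i : ι) {k : ℕ}
    (M : Matrix (Fin k) (Fin k) (A i)) :
    ‖opMatrix (M.map (Q.π i))‖ ≤ matNorm _ (M.map (freeProduct.incl.{u, v, w} A δ i)) := by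
  have hcomp : (M.map (freeProduct.incl A δ i)).map Q.freeProductRep = M.map (Q.π i) := by
    ext1 j l
    exact Q.freeProductRep_incl i (M j l)
  exact hcomp ▸ Q.isCompletelyContractiveRep_freeProductRep k (M.map (freeProduct.incl A δ i))

/-- The restriction of an amalgamated family of representations to a common invariant subspace. -/
def restrict {H : Type w} [NormedAddCommGroup H] [InnerProductSpace ℂ H] [CompleteSpace H]
    (Q : AmalgamatedRep.{u, v, t} A δ) (V : H →ₗᵢ[ℂ] Q.H)
    (hV : ∀ i a, Set.MapsTo (Q.π i a) V.range V.range) : AmalgamatedRep.{u, v, w} A δ where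
  H := H
  π i := restrictRep (Q.π i) V (hV i)
  contractive i := IsCompletelyContractiveRep.restrictRep (Q.contractive i) (hV i)
  agree i j d := by
    ext x
    apply V.injective
    rw [linearIsometry_restrictRep_apply, linearIsometry_restrictRep_apply, Q.agree i j]

theorem exists_isHilbertSum_intertwining [∀ i, Small.{w} (A i)]
    (Q : AmalgamatedRep.{u, v, t} A δ) :
    ∃ (J : Type t) (P : J → AmalgamatedRep.{u, v, w} A δ) (V : ∀ j, (P j).H →ₗᵢ[ℂ] Q.H),
      IsHilbertSum ℂ (fun j => (P j).H) V ∧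
        ∀ j i a x, V j ((P j).π i a x) = Q.π i a (V j x) := by
  let S : Set (BOp Q.H) := ⋃ i, Set.range (Q.π i) ∪ Set.range fun a => star (Q.π i a)
  have hstar : ∀ T ∈ S, star T ∈ S := fun T hT => by
    obtain ⟨i, ⟨a, rfl⟩ | ⟨a, rfl⟩⟩ := Set.mem_iUnion.1 hT
    · exact Set.mem_iUnion.2 ⟨i, Or.inr ⟨a, rfl⟩⟩
    · exact Set.mem_iUnion.2 ⟨i, Or.inl ⟨a, (star_star _).symm⟩⟩
  obtain ⟨J, κ, V, hsum, hmaps⟩ := exists_isHilbertSum_lp_mapsTo_range.{t, w} S hstar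
  have hV : ∀ j i a, Set.MapsTo (Q.π i a) (V j).range (V j).range := fun j i a =>
    hmaps _ (Set.mem_iUnion.2 ⟨i, Or.inl ⟨a, rfl⟩⟩) j
  exact ⟨J, fun j => Q.restrict (V j) (hV j), V, hsum, fun j i a x =>
    linearIsometry_restrictRep_apply (hV j i) a x⟩

theorem exists_isCompletelyContractiveRep_freeProduct [∀ i, Small.{w} (A i)]
    (Q : AmalgamatedRep.{u, v, t} A δ) : ∃ φ : freeProduct.{u, v, w} A δ →ₙₐ[ℂ] BOp Q.H,
      IsCompletelyContractiveRep φ ∧ ∀ i a, φ (freeProduct.incl A δ i a) = Q.π i a := by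
  obtain ⟨J, P, V, hsum, hV⟩ := Q.exists_isHilbertSum_intertwining
  let e := hsum.linearIsometryEquiv
  have hP : ∀ j, IsCompletelyContractiveRep (P j).freeProductRep := fun j =>
    (P j).isCompletelyContractiveRep_freeProductRep
  let ρ : freeProduct.{u, v, w} A δ →ₙₐ[ℂ] BOp (lp (fun j => (P j).H) 2) :=
    directSumRep (fun j => (P j).freeProductRep)
      (IsCompletelyContractiveRep.exists_norm_apply_le hP)
  have hρ : IsCompletelyContractiveRep ρ := isCompletelyContractiveRep_directSumRep hP _
  have hrange : ∀ b, Set.MapsTo (ρ b) e.toLinearIsometry.range e.toLinearIsometry.range :=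
    fun b x _ => ⟨e.symm (ρ b x), e.apply_symm_apply _⟩
  refine ⟨restrictRep ρ e.toLinearIsometry hrange, hρ.restrictRep hrange, fun i a => ?_⟩
  have hintertwine y : e.symm (ρ (freeProduct.incl A δ i a) y) = Q.π i a (e.symm y) := by
    have hleft := hsum.hasSum_linearIsometryEquiv_symm (ρ (freeProduct.incl A δ i a) y)
    have hright := (hsum.hasSum_linearIsometryEquiv_symm y).mapL (Q.π i a)
    refine hleft.unique ?_
    convert hright using 2 with j
    rw [← hV, ← freeProductRep_incl]
    rfl
  ext x
  apply e.injective
  calc e (restrictRep ρ e.toLinearIsometry hrange (freeProduct.incl A δ i a) x)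
      = ρ (freeProduct.incl A δ i a) (e x) := linearIsometry_restrictRep_apply hrange _ x
    _ = e (Q.π i a x) := by rw [← e.symm_apply_eq, hintertwine, e.symm_apply_apply]

end AmalgamatedRep

theorem freeProduct.existsUnique_hom [∀ i, Small.{w} (A i)] {H : Type t} [NormedAddCommGroup H]
    [InnerProductSpace ℂ H] [CompleteSpace H] {B : NonUnitalSubalgebra ℂ (BOp H)}
    (hB : IsClosed (B : Set (BOp H))) {π : ∀ i, A i →ₙₐ[ℂ] B}
    (hπ : ∀ i, CompletelyContractive (π i)) (hagree : ∀ i j d, π i (δ i d) = π j (δ j d)) :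
    ∃! φ : freeProduct.{u, v, w} A δ →ₙₐ[ℂ] B,
      CompletelyContractive φ ∧ ∀ i a, φ (freeProduct.incl A δ i a) = π i a := by
  let Q : AmalgamatedRep.{u, v, t} A δ :=
    { H := H
      π := fun i => (NonUnitalSubalgebraClass.subtype B).comp (π i)
      contractive := fun i => (hπ i).subtype_comp
      agree := fun i j d => congr_arg Subtype.val (hagree i j d) }
  obtain ⟨φ, hφ, hincl⟩ := Q.exists_isCompletelyContractiveRep_freeProduct
  have hmem : ∀ x, φ x ∈ B := freeProduct.map_mem_of_isClosed hφ.continuous hB fun i a =>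
    (hincl i a).symm ▸ (π i a).2
  refine ⟨NonUnitalAlgHom.codRestrict φ B hmem, ⟨hφ.codRestrict hmem, fun i a =>
    Subtype.ext (hincl i a)⟩, fun ψ ⟨hψ, hψincl⟩ => ?_⟩
  exact freeProduct.hom_ext hψ.continuous (hφ.codRestrict hmem).continuous fun i a =>
    (hψincl i a).trans (Subtype.ext (hincl i a)).symm

end FreeProduct

/-! ### Representations of semicrossed products -/

section Semicrossed

variable {X : Type u} [TopologicalSpace X] {ι : Type} {τ : ι → C(X, X)}

instance small_semicrossedProduct : Small.{u} (semicrossedProduct τ) := by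
  let S : Set (BOp (UniversalSpace τ)) :=
    Set.range (univRep τ) ∪ ⋃ i, Set.range fun f => univS τ i * univRep τ f
  have hle : (semicrossedProduct τ : Set (BOp (UniversalSpace τ))) ⊆
      closure (Algebra.adjoin ℂ S : Set (BOp (UniversalSpace τ))) :=
    closure_mono (NonUnitalAlgebra.adjoin_le_algebra_adjoin ℂ S)
  have hadjoin : Small.{u} (Algebra.adjoin ℂ S) := small_algebra_adjoin S
  have hclosure := small_closure.{u} (Algebra.adjoin ℂ S : Set (BOp (UniversalSpace τ)))
  exact small_subset hle

namespace semicrossedProduct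

theorem le_diagonalAlgebra : semicrossedProduct τ ≤ diagonalAlgebra _ := by
  refine NonUnitalSubalgebra.topologicalClosure_minimal (NonUnitalAlgebra.adjoin_le ?_)
    (isClosed_diagonalAlgebra _)
  refine Set.union_subset (Set.range_subset_iff.2 fun f => ?_)
    (Set.iUnion_subset fun i => Set.range_subset_iff.2 fun f => ?_)
  · exact mem_diagonalAlgebra_of_apply_coord (S := fun R : CovariantRep τ => R.π f) fun _ _ => rfl
  · exact mem_diagonalAlgebra_of_apply_coord (S := fun R : CovariantRep τ => R.S i * R.π f)
      fun _ _ => rfl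

theorem norm_coeff_le (f : C₀(X, ℂ)) : ‖coeff τ f‖ ≤ ‖f‖ :=
  lp.norm_mapCLM_le 2 _ (norm_nonneg f) fun R => NonUnitalStarAlgHom.norm_apply_le R.π f

theorem norm_univS_le (i : ι) : ‖univS τ i‖ ≤ 1 :=
  lp.norm_mapCLM_le 2 _ zero_le_one fun R => R.norm_S_le i

theorem norm_gen_le (i : ι) (f : C₀(X, ℂ)) : ‖gen τ i f‖ ≤ ‖f‖ :=
  (norm_mul_le_of_le (norm_univS_le i) (norm_coeff_le f)).trans_eq (one_mul _)

/-- The map `f ↦ S i * f`. -/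
def genLinearMap (i : ι) : C₀(X, ℂ) →ₗ[ℂ] semicrossedProduct τ where
  toFun := gen τ i
  map_add' f g := Subtype.ext <| by simp [gen, mul_add]
  map_smul' c f := Subtype.ext <| by simp [gen]

theorem gen_mul_coeff (i : ι) (f g : C₀(X, ℂ)) : gen τ i f * coeff τ g = gen τ i (f * g) :=
  Subtype.ext <| by simp [gen, coeff, mul_assoc]

theorem coeff_mul_gen (i : ι) (f g : C₀(X, ℂ)) :
    coeff τ f * gen τ i g = gen τ i (compMul (τ i) f g) := by
  refine Subtype.ext (ContinuousLinearMap.ext fun x => ?_)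
  ext R
  exact DFunLike.congr_fun (R.covariance i f g) (x R)

theorem exists_contraction_map_gen {H : Type*} [NormedAddCommGroup H]
    [InnerProductSpace ℂ H] [CompleteSpace H] {ρ : semicrossedProduct τ →ₙₐ[ℂ] BOp H}
    (hρ : ∀ a, ‖ρ a‖ ≤ ‖a‖) (i : ι) :
    ∃ S : BOp H, ‖S‖ ≤ 1 ∧ ∀ f, ρ (gen τ i f) = S * ρ (coeff τ f) := by
  let s : C₀(X, ℂ) →ₗ[ℂ] BOp H := LinearMapClass.linearMap ρ ∘ₗ genLinearMap i
  have hs f : ‖s f‖ ≤ ‖f‖ := (hρ _).trans (norm_gen_le i f)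
  have hmul f g : s (f * g) = s f * (ρ.comp (coeff τ)) g :=
    calc ρ (gen τ i (f * g)) = ρ (gen τ i f * coeff τ g) := by rw [gen_mul_coeff]
      _ = ρ (gen τ i f) * ρ (coeff τ g) := map_mul ρ _ _
  exact exists_contraction_mul_eq hs hmul

theorem exists_completelyContractive_of_eq_coe {H : Type*} [NormedAddCommGroup H]
    [InnerProductSpace ℂ H] {φ : semicrossedProduct τ →ₙₐ[ℂ] BOp H}
    (hφ : IsCompletelyContractiveRep φ) {B : NonUnitalSubalgebra ℂ (BOp H)}
    (hB : IsClosed (B : Set (BOp H))) {b : C₀(X, ℂ) → B} {s : ι → C₀(X, ℂ) → B}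
    (hcoeff : ∀ f, φ (coeff τ f) = b f) (hgen : ∀ i f, φ (gen τ i f) = s i f) :
    ∃ Φ : semicrossedProduct τ →ₙₐ[ℂ] B, CompletelyContractive Φ ∧
      (∀ f, Φ (coeff τ f) = b f) ∧ ∀ i f, Φ (gen τ i f) = s i f :=
  have hmem : ∀ a, φ a ∈ B := map_mem_of_isClosed τ hφ.continuous hB
    (fun f => hcoeff f ▸ (b f).2) fun i f => hgen i f ▸ (s i f).2
  ⟨NonUnitalAlgHom.codRestrict φ B hmem, hφ.codRestrict hmem,
    fun f => Subtype.ext (hcoeff f), fun i f => Subtype.ext (hgen i f)⟩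

end semicrossedProduct

namespace CovariantRep

/-- The representation of the semicrossed product on a summand of its Hilbert space. -/
def semicrossedProductRep (R : CovariantRep τ) : semicrossedProduct τ →ₙₐ[ℂ] BOp R.H :=
  summandRep semicrossedProduct.le_diagonalAlgebra R

theorem isCompletelyContractiveRep_semicrossedProductRep (R : CovariantRep τ) :
    IsCompletelyContractiveRep R.semicrossedProductRep :=
  isCompletelyContractiveRep_summandRep _ R

@[simp]
theorem semicrossedProductRep_coeff (R : CovariantRep τ) (f : C₀(X, ℂ)) :
    R.semicrossedProductRep (semicrossedProduct.coeff τ f) = R.π f :=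
  compression_eq_of_apply_coord fun _ => rfl

@[simp]
theorem semicrossedProductRep_gen (R : CovariantRep τ) (i : ι) (f : C₀(X, ℂ)) :
    R.semicrossedProductRep (semicrossedProduct.gen τ i f) = R.S i * R.π f :=
  compression_eq_of_apply_coord fun _ => rfl

/-- The restriction of a covariant representation to one of the maps. -/
def single (R : CovariantRep τ) (i : ι) : CovariantRep fun _ : Unit => τ i where
  H := R.H
  π := R.π
  S _ := R.S i
  norm_S_le _ := R.norm_S_le i
  covariance _ := R.covariance i

theorem single_surjective (i : ι) : Function.Surjective fun R : CovariantRep τ => R.single i := by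
  classical
  intro R
  refine ⟨{ H := R.H
            π := R.π
            S := fun j => if j = i then R.S () else 0
            norm_S_le := fun j => ?_
            covariance := fun j f g => ?_ }, ?_⟩
  · split_ifs
    · exact R.norm_S_le ()
    · simp
  · split_ifs with h
    · exact h ▸ R.covariance () f g
    · simp
  · cases R
    simp [single]

end CovariantRep

end Semicrossed

/-! ### The free product of Peters' semicrossed products -/

theorem semicrossedProduct.exists_completelyContractive_freeProduct {X : Type u}
    [TopologicalSpace X] {ι : Type} [Nonempty ι] {τ : ι → C(X, X)} {K : ι → Type v}
    [∀ i, NormedAddCommGroup (K i)] [∀ i, InnerProductSpace ℂ (K i)]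
    {A : ∀ i, NonUnitalSubalgebra ℂ (BOp (K i))} {δ : ∀ i, C₀(X, ℂ) →ₙₐ[ℂ] A i}
    {s : ∀ i, C₀(X, ℂ) → A i}
    (h : ∀ Q : AmalgamatedRep.{u, v, w} A δ, ∃ φ : semicrossedProduct τ →ₙₐ[ℂ] BOp Q.H,
      IsCompletelyContractiveRep φ ∧ (∀ i f, φ (coeff τ f) = Q.π i (δ i f)) ∧
        ∀ i f, φ (gen τ i f) = Q.π i (s i f)) :
    ∃ Φ : semicrossedProduct τ →ₙₐ[ℂ] freeProduct.{u, v, w} A δ, CompletelyContractive Φ ∧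
      (∀ i f, Φ (coeff τ f) = freeProduct.incl A δ i (δ i f)) ∧
        ∀ i f, Φ (gen τ i f) = freeProduct.incl A δ i (s i f) := by
  choose ρ hρ hρ_coeff hρ_gen using h
  let φ : semicrossedProduct τ →ₙₐ[ℂ] BOp (lp (fun Q : AmalgamatedRep.{u, v, w} A δ => Q.H) 2) :=
    directSumRep ρ (IsCompletelyContractiveRep.exists_norm_apply_le hρ)
  have hφ : IsCompletelyContractiveRep φ := isCompletelyContractiveRep_directSumRep hρ _
  have hcoeff i f : φ (coeff τ f) = freeProduct.incl A δ i (δ i f) := by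
    ext x Q
    exact DFunLike.congr_fun (hρ_coeff Q i f) (x Q)
  have hgen i f : φ (gen τ i f) = freeProduct.incl A δ i (s i f) := by
    ext x Q
    exact DFunLike.congr_fun (hρ_gen Q i f) (x Q)
  let i₀ : ι := Classical.arbitrary ι
  exact (exists_completelyContractive_of_eq_coe hφ
    (NonUnitalSubalgebra.isClosed_topologicalClosure _) (hcoeff i₀) hgen).imp fun Φ hΦ =>
      ⟨hΦ.1, fun i f => (hΦ.2.1 f).trans (freeProduct.incl_amalgam i₀ i f), hΦ.2.2⟩

section Peters

open semicrossedProduct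

variable {X : Type u} [TopologicalSpace X] {ι : Type} (τ : ι → C(X, X))

/-- The family of Peters' semicrossed products of the single maps `τ i`. -/
abbrev petersFamily (i : ι) := petersSemicrossedProduct (τ i)

/-- The inclusions of `C₀(X)` in Peters' semicrossed products. -/
abbrev petersCoeff (i : ι) : C₀(X, ℂ) →ₙₐ[ℂ] petersFamily τ i := coeff fun _ : Unit => τ i

/-- The elements `S f` of Peters' semicrossed products. -/
abbrev petersGen (i : ι) (f : C₀(X, ℂ)) : petersFamily τ i := gen (fun _ : Unit => τ i) () f

/-- The free product of Peters' semicrossed products with amalgamation over `C₀(X)`. -/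
abbrev petersFreeProduct := freeProduct.{u, u + 1, u} (petersFamily τ) (petersCoeff τ)

/-- The inclusions of Peters' semicrossed products in their free product. -/
abbrev petersIncl (i : ι) : petersFamily τ i →ₙₐ[ℂ] petersFreeProduct τ :=
  freeProduct.incl (petersFamily τ) (petersCoeff τ) i

variable {τ}

/-- The representations of Peters' semicrossed products given by a covariant representation. -/
def CovariantRep.toAmalgamatedRep (R : CovariantRep τ) :
    AmalgamatedRep.{u, u + 1, u} (petersFamily τ) (petersCoeff τ) where
  H := R.H
  π i := (R.single i).semicrossedProductRep
  contractive i := (R.single i).isCompletelyContractiveRep_semicrossedProductRep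
  agree i j f := ((R.single i).semicrossedProductRep_coeff f).trans
    ((R.single j).semicrossedProductRep_coeff f).symm

theorem AmalgamatedRep.exists_isCompletelyContractiveRep_semicrossedProduct [Nonempty ι]
    (Q : AmalgamatedRep.{u, u + 1, u} (petersFamily τ) (petersCoeff τ)) :
    ∃ φ : semicrossedProduct τ →ₙₐ[ℂ] BOp Q.H, IsCompletelyContractiveRep φ ∧
      (∀ i f, φ (coeff τ f) = Q.π i (petersCoeff τ i f)) ∧
      ∀ i f, φ (gen τ i f) = Q.π i (petersGen τ i f) := by
  have hQ i a : ‖Q.π i a‖ ≤ ‖a‖ := IsCompletelyContractiveRep.norm_apply_le (Q.contractive i) a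
  choose S hS hgen using fun i => exists_contraction_map_gen (hQ i) ()
  let i₀ : ι := Classical.arbitrary ι
  let π : C₀(X, ℂ) →ₙₐ[ℂ] BOp Q.H := (Q.π i₀).comp (petersCoeff τ i₀)
  have hπ f : ‖π f‖ ≤ ‖f‖ := (hQ i₀ _).trans (norm_coeff_le f)
  have hπ_eq i f : π f = Q.π i (petersCoeff τ i f) := Q.agree i₀ i f
  let R : CovariantRep τ :=
    { H := Q.H
      π := { π with map_star' := map_star_of_norm_map_le hπ }
      S := S
      norm_S_le := hS
      covariance := fun i f g => by
        change π f * S i * π g = S i * π (compMul (τ i) f g)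
        rw [hπ_eq i, hπ_eq i, hπ_eq i, mul_assoc, ← hgen, ← hgen, ← map_mul, coeff_mul_gen] }
  refine ⟨R.semicrossedProductRep, R.isCompletelyContractiveRep_semicrossedProductRep,
    fun i f => (R.semicrossedProductRep_coeff f).trans (hπ_eq i f), fun i f => ?_⟩
  calc R.semicrossedProductRep (gen τ i f) = S i * π f := R.semicrossedProductRep_gen i f
    _ = Q.π i (petersGen τ i f) := by rw [hgen, hπ_eq i]

theorem completelyIsometric_incl_petersFamily (i : ι) :
    CompletelyIsometric (petersIncl τ i) := by
  have hcontr : CompletelyContractive (petersIncl τ i) := freeProduct.completelyContractive_incl i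
  refine fun k M => le_antisymm (hcontr k M) ?_
  have hR (R : CovariantRep τ) :
      ‖opMatrix (M.map (R.single i).semicrossedProductRep)‖ ≤ matNorm _ (M.map (petersIncl τ i)) :=
    R.toAmalgamatedRep.norm_opMatrix_map_le_matNorm_incl i M
  exact matNorm_le_of_summandRep_le le_diagonalAlgebra (ContinuousLinearMap.opNorm_nonneg _)
    ((CovariantRep.single_surjective i).forall.2 hR)

theorem isAmalgamatedFreeProduct_petersFamily :
    IsAmalgamatedFreeProduct.{u, u + 1, v} (petersFamily τ) (petersCoeff τ)
      (petersFreeProduct τ) (petersIncl τ) :=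
  ⟨NonUnitalSubalgebra.isClosed_topologicalClosure _, completelyIsometric_incl_petersFamily,
    freeProduct.incl_amalgam, fun _ _ _ _ _ hB _ => freeProduct.existsUnique_hom hB⟩

variable (τ)

theorem exists_completelyContractive_petersFamily (i : ι) :
    ∃ φ : petersFamily τ i →ₙₐ[ℂ] semicrossedProduct τ, CompletelyContractive φ ∧
      (∀ f, φ (petersCoeff τ i f) = coeff τ f) ∧ ∀ f, φ (petersGen τ i f) = gen τ i f := by
  have hrep (R : CovariantRep τ) :=
    (R.single i).isCompletelyContractiveRep_semicrossedProductRep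
  let φ : petersFamily τ i →ₙₐ[ℂ] BOp (UniversalSpace τ) :=
    directSumRep (fun R : CovariantRep τ => (R.single i).semicrossedProductRep)
      (IsCompletelyContractiveRep.exists_norm_apply_le hrep)
  have hφ : IsCompletelyContractiveRep φ := isCompletelyContractiveRep_directSumRep hrep _
  have hcoeff f : φ (petersCoeff τ i f) = coeff τ f := by
    ext x R
    exact DFunLike.congr_fun ((R.single i).semicrossedProductRep_coeff f) (x R)
  have hgen f : φ (petersGen τ i f) = gen τ i f := by
    ext x R
    exact DFunLike.congr_fun ((R.single i).semicrossedProductRep_gen () f) (x R)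
  exact (exists_completelyContractive_of_eq_coe hφ
    (NonUnitalSubalgebra.isClosed_topologicalClosure _) hcoeff fun _ => hgen).imp
      fun Φ hΦ => ⟨hΦ.1, hΦ.2.1, hΦ.2.2 ()⟩

theorem exists_completelyContractive_semicrossedProduct_freeProduct [Nonempty ι] :
    ∃ Φ : semicrossedProduct τ →ₙₐ[ℂ] petersFreeProduct τ,
      CompletelyContractive Φ ∧
      (∀ i f, Φ (coeff τ f) = petersIncl τ i (petersCoeff τ i f)) ∧
      ∀ i f, Φ (gen τ i f) = petersIncl τ i (petersGen τ i f) :=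
  exists_completelyContractive_freeProduct
    AmalgamatedRep.exists_isCompletelyContractiveRep_semicrossedProduct

theorem exists_completelyContractive_freeProduct_semicrossedProduct :
    ∃ Ψ : petersFreeProduct τ →ₙₐ[ℂ] semicrossedProduct τ,
      CompletelyContractive Ψ ∧
      (∀ i f, Ψ (petersIncl τ i (petersCoeff τ i f)) = coeff τ f) ∧
      ∀ i f, Ψ (petersIncl τ i (petersGen τ i f)) = gen τ i f := by
  choose π hπ hcoeff hgen using exists_completelyContractive_petersFamily τ
  have hagree i j f : π i (petersCoeff τ i f) = π j (petersCoeff τ j f) :=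
    (hcoeff i f).trans (hcoeff j f).symm
  exact (freeProduct.existsUnique_hom (A := petersFamily τ) (δ := petersCoeff τ)
    (NonUnitalSubalgebra.isClosed_topologicalClosure _) hπ hagree).exists.imp
    fun Ψ hΨ => ⟨hΨ.1, fun i f => (hΨ.2 i _).trans (hcoeff i f),
      fun i f => (hΨ.2 i _).trans (hgen i f)⟩

variable {τ}

theorem petersFreeProduct_hom_ext {B : Type*} [NonUnitalNonAssocSemiring B] [Module ℂ B]
    [TopologicalSpace B] [T2Space B] {φ ψ : petersFreeProduct τ →ₙₐ[ℂ] B}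
    (hφ : Continuous φ) (hψ : Continuous ψ)
    (hcoeff : ∀ i f, φ (petersIncl τ i (petersCoeff τ i f)) =
      ψ (petersIncl τ i (petersCoeff τ i f)))
    (hgen : ∀ i f, φ (petersIncl τ i (petersGen τ i f)) =
      ψ (petersIncl τ i (petersGen τ i f))) : φ = ψ := by
  refine freeProduct.hom_ext hφ hψ fun i => ?_
  have hincl := (freeProduct.completelyContractive_incl (δ := petersCoeff τ) i).continuous
  have hcomp : φ.comp (petersIncl τ i) = ψ.comp (petersIncl τ i) :=
    hom_ext (hφ.comp hincl) (hψ.comp hincl) (hcoeff i) fun _ => hgen i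
  exact DFunLike.congr_fun hcomp

section Inverse

variable {Φ : semicrossedProduct τ →ₙₐ[ℂ] petersFreeProduct τ}
  {Ψ : petersFreeProduct τ →ₙₐ[ℂ] semicrossedProduct τ}
  (hΦ : Continuous Φ) (hΨ : Continuous Ψ)
  (hΦcoeff : ∀ i f, Φ (coeff τ f) = petersIncl τ i (petersCoeff τ i f))
  (hΦgen : ∀ i f, Φ (gen τ i f) = petersIncl τ i (petersGen τ i f))
  (hΨcoeff : ∀ i f, Ψ (petersIncl τ i (petersCoeff τ i f)) = coeff τ f)
  (hΨgen : ∀ i f, Ψ (petersIncl τ i (petersGen τ i f)) = gen τ i f)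

include hΦ hΨ hΦcoeff hΦgen hΨcoeff hΨgen

theorem leftInverse_freeProduct_semicrossedProduct [Nonempty ι] : Function.LeftInverse Ψ Φ := by
  have hcomp : Ψ.comp Φ = NonUnitalAlgHom.id ℂ _ :=
    hom_ext (hΨ.comp hΦ) continuous_id
      (fun f => (congr_arg Ψ (hΦcoeff (Classical.arbitrary ι) f)).trans (hΨcoeff _ f))
      fun i f => (congr_arg Ψ (hΦgen i f)).trans (hΨgen i f)
  exact DFunLike.congr_fun hcomp

theorem rightInverse_freeProduct_semicrossedProduct : Function.RightInverse Ψ Φ := by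
  have hcomp : Φ.comp Ψ = NonUnitalAlgHom.id ℂ _ :=
    petersFreeProduct_hom_ext (hΦ.comp hΨ) continuous_id
      (fun i f => (congr_arg Φ (hΨcoeff i f)).trans (hΦcoeff i f))
      fun i f => (congr_arg Φ (hΨgen i f)).trans (hΦgen i f)
  exact DFunLike.congr_fun hcomp

end Inverse

end Peters

theorem theorem2_general {X : Type u} [TopologicalSpace X] {ι : Type} [Nonempty ι]
    (τ : ι → C(X, X)) :
    IsAmalgamatedFreeProduct.{u, u + 1, v} (petersFamily τ) (petersCoeff τ)
      (petersFreeProduct τ) (petersIncl τ) ∧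
    ∃ Φ : semicrossedProduct τ →ₙₐ[ℂ] petersFreeProduct τ,
      CompletelyIsometric Φ ∧ Function.Surjective Φ ∧
      (∀ i f, Φ (semicrossedProduct.coeff τ f) = petersIncl τ i (petersCoeff τ i f)) ∧
      ∀ i f, Φ (semicrossedProduct.gen τ i f) = petersIncl τ i (petersGen τ i f) := by
  refine ⟨isAmalgamatedFreeProduct_petersFamily,
    (exists_completelyContractive_semicrossedProduct_freeProduct τ).imp fun Φ hΦ =>
      (exists_completelyContractive_freeProduct_semicrossedProduct τ).elim fun Ψ hΨ => ?_⟩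
  have hleft : Function.LeftInverse Ψ Φ := leftInverse_freeProduct_semicrossedProduct
    hΦ.1.continuous hΨ.1.continuous hΦ.2.1 hΦ.2.2 hΨ.2.1 hΨ.2.2
  have hright : Function.RightInverse Ψ Φ := rightInverse_freeProduct_semicrossedProduct
    hΦ.1.continuous hΨ.1.continuous hΦ.2.1 hΦ.2.2 hΨ.2.1 hΨ.2.2
  exact ⟨hΦ.1.completelyIsometric_of_leftInverse hΨ.1 hleft, hright.surjective, hΦ.2⟩

end

theorem theorem2 {X : Type u} [TopologicalSpace X] [LocallyCompactSpace X] [T2Space X]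
    {n : ℕ} (hn : 1 ≤ n) (τ : Fin n → C(X, X)) :
    IsAmalgamatedFreeProduct.{u, u + 1, v}
      (fun i => petersSemicrossedProduct (τ i))
      (fun i => semicrossedProduct.coeff fun _ : Unit => τ i)
      (freeProduct.{u, u + 1, u}
        (fun i => petersSemicrossedProduct (τ i))
        (fun i => semicrossedProduct.coeff fun _ : Unit => τ i))
      (freeProduct.incl.{u, u + 1, u}
        (fun i => petersSemicrossedProduct (τ i))
        (fun i => semicrossedProduct.coeff fun _ : Unit => τ i)) ∧
    ∃ Φ : semicrossedProduct τ →ₙₐ[ℂ]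
        freeProduct.{u, u + 1, u}
          (fun i => petersSemicrossedProduct (τ i))
          (fun i => semicrossedProduct.coeff fun _ : Unit => τ i),
      CompletelyIsometric Φ ∧ Function.Surjective Φ ∧
      (∀ i f, Φ (semicrossedProduct.coeff τ f) =
        freeProduct.incl.{u, u + 1, u} _ _ i (semicrossedProduct.coeff (fun _ : Unit => τ i) f)) ∧
      ∀ i f, Φ (semicrossedProduct.gen τ i f) =
        freeProduct.incl.{u, u + 1, u} _ _ i
          (semicrossedProduct.gen (fun _ : Unit => τ i) () f) := by
  have : Nonempty (Fin n) := ⟨⟨0, hn⟩⟩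
  exact theorem2_general τ
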